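/- Let $k$ be an algebraically closed field of characteristic $0$. A Kronecker–Weierstrass block over a polynomial ring $S=k[x_1,\dots,x_n]$ is a matrix of one of the following types, whose entries are built from linear forms of $S$: a nilpotent block of length $m\ge 1$, $$\begin{pmatrix}0&u_1&\cdots&u_{m-2}&u_{m-1}\\u_1&u_2&\cdots&u_{m-1}&0\end{pmatrix};$$ a scroll block of length $s\ge 0$, $$\begin{pmatrix}y_1&y_2&\cdots&y_s\\y_2&y_3&\cdots&y_{s+1}\end{pmatrix}$$ (for $s=0$ it has no column and consists of one form $y_1$, which does not occur in the matrix); a Jordan block of length $p\ge 1$ with eigenvalue $\lambda\in k$, $$\begin{pmatrix}z_1&\cdots&z_{p-1}&z_p\\z_2+\lambda z_1&\cdots&z_p+\lambda z_{p-1}&\lambda z_p\end{pmatrix}.$$ A Kronecker–Weierstrass matrix over $S$ is a concatenation of such blocks in which the forms $u,y,z$ of all the blocks together are a $k$-basis of the space $S_1$ of linear forms. A Kronecker–Weierstrass normal form of a $2\times e$ matrix $Y$ of linear forms of $S$ is a Kronecker–Weierstrass matrix of the form $PYC$ with $P\in \mathrm{GL}_2(k)$, $C\in\mathrm{GL}_e(k)$.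 The determinantal ring of $Y$ is $S/I_2(Y)$, where $I_2(Y)$ is the ideal generated by the $2$-minors of $Y$. Let $X$ be a $2\times e$ Kronecker–Weierstrass matrix over $S=k[x_1,\dots,x_n]$, let $R=S/I_2(X)$ be its determinantal ring, and let $R'=R/(l_1,\dots,l_r)$, where $l_1,\dots,l_r$ are linear forms. Then there are an integer $n'\ge 0$ and a surjective $k$-algebra homomorphism $\varphi:S\to S'=k[x_1,\dots,x_{n'}]$ which maps linear forms to linear forms and has kernel $(l_1,\dots,l_r)$ (the elimination of variables by means of $l_1,\dots,l_r$). For every such $\varphi$, the $2\times e$ matrix $X'=\varphi(X)$, whose entries are linear forms of $S'$, satisfies the following. 1. $R'$ is the determinantal ring of $X'$: the map $\varphi$ induces an isomorphism of $k$-algebras $R'\cong S'/I_2(X')$. 2. If some Kronecker–Weierstrass normal form of $X'$ has a scroll block of length $s$, then $X$ has a scroll block of length $t$ for some $t\le s$; if $s\ge1$, then $t$ can be chosen with $1\le t\le s$. -/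

import Mathlib

/-- The ideal `I₂(X)` generated by the `2`-minors of a matrix with two rows. -/
def minorsIdeal {S : Type*} [CommRing S] {e : ℕ} (X : Matrix (Fin 2) (Fin e) S) : Ideal S :=
  Ideal.span (Set.range fun c : Fin e × Fin e => (X.submatrix id ![c.1, c.2]).det)

/-- The determinantal ring `S / I₂(X)`. -/
abbrev DetRing {S : Type*} [CommRing S] {e : ℕ} (X : Matrix (Fin 2) (Fin e) S) : Type _ :=
  S ⧸ minorsIdeal X

/-- The quotient `R / (l₁, …, lᵣ)` of the determinantal ring `R = S / I₂(X)` by the classes of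
elements `l₁, …, lᵣ` of `S`. -/
abbrev DetRingQuot {S : Type*} [CommRing S] {e r : ℕ} (X : Matrix (Fin 2) (Fin e) S)
    (l : Fin r → S) : Type _ :=
  DetRing X ⧸ Ideal.span (Set.range fun i => Ideal.Quotient.mk (minorsIdeal X) (l i))

/-- The three types of Kronecker-Weierstrass blocks; the number is the length of the block. -/
inductive KWBlock (k : Type*) where
  | nilpotent (m : ℕ) : KWBlock k
  | scroll (n : ℕ) : KWBlock k
  | jordan (p : ℕ) (lam : k) : KWBlock k

namespace KWBlock

variable {k : Type*}

/-- Nilpotent and Jordan blocks have length at least one. A scroll block may have length zero: it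
has one variable and no column, and accounts for a variable which does not occur in the matrix. -/
def Proper : KWBlock k → Prop
  | nilpotent m => 1 ≤ m
  | scroll _ => True
  | jordan p _ => 1 ≤ p

/-- The number of columns of a block, which is its length. -/
def cols : KWBlock k → ℕ
  | nilpotent m => m
  | scroll n => n
  | jordan p _ => p

/-- The number of variables of a block. -/
def vars : KWBlock k → ℕ
  | nilpotent m => m - 1
  | scroll n => n + 1
  | jordan p _ => p

/-- A finite family, extended by zero. -/
def extend {S : Type*} [Zero S] {N : ℕ} (y : Fin N → S) (j : ℕ) : S :=
  if h : j < N then y ⟨j, h⟩ else 0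

/-- The `2 × b.cols` matrix of the block `b` on the entries `y`. With `y = (y₁, y₂, …)`:
* nilpotent block of length `m`, first row `0, y₁, …, yₘ₋₁`, second row `y₁, …, yₘ₋₁, 0`;
* scroll block of length `n`, first row `y₁, …, yₙ`, second row `y₂, …, yₙ₊₁`;
* Jordan block of length `p` with eigenvalue `c`, first row `y₁, …, yₚ`,
  second row `y₂ + c y₁, …, yₚ + c yₚ₋₁, c yₚ`. -/
def toMatrix {S : Type*} [CommRing S] [SMul k S] :
    (b : KWBlock k) → (Fin b.vars → S) → Matrix (Fin 2) (Fin b.cols) S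
  | nilpotent _, y => Matrix.of
      ![fun j => if j.val = 0 then 0 else extend y (j.val - 1), fun j => extend y j.val]
  | scroll _, y => Matrix.of
      ![fun j => extend y j.val, fun j => extend y (j.val + 1)]
  | jordan _ c, y => Matrix.of
      ![fun j => extend y j.val, fun j => extend y (j.val + 1) + c • extend y j.val]

end KWBlock

/-- `X` is the Kronecker-Weierstrass matrix with the sequence of blocks `b`: it is the
concatenation of the blocks `b 0, b 1, …`, written in linear forms which together (over all the
blocks) are a `k`-basis of the space of linear forms of `k[x₁, …, xₙ]`. -/
def IsKWMatrix {k : Type*} [Field k] {n e N : ℕ} (b : Fin N → KWBlock k)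
    (X : Matrix (Fin 2) (Fin e) (MvPolynomial (Fin n) k)) : Prop :=
  (∀ i, (b i).Proper) ∧
  ∃ (he : ∑ i, (b i).cols = e) (y : (i : Fin N) → Fin (b i).vars → MvPolynomial (Fin n) k),
    LinearIndependent k (fun p : (Σ i, Fin (b i).vars) => y p.1 p.2) ∧
    Submodule.span k (Set.range fun p : (Σ i, Fin (b i).vars) => y p.1 p.2) =
      MvPolynomial.homogeneousSubmodule (Fin n) k 1 ∧
    ∀ (a : Fin 2) (i : Fin N) (j : Fin (b i).cols),
      X a (Fin.cast he (finSigmaFinEquiv ⟨i, j⟩)) = (b i).toMatrix (y i) a j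

/-- The sequence of blocks `b` is that of a Kronecker-Weierstrass normal form of `X`: an invertible
scalar row operation and an invertible scalar column operation turn `X` into the
Kronecker-Weierstrass matrix with blocks `b` in some basis of the space of linear forms. -/
def IsKWNormalForm {k : Type*} [Field k] {n e N : ℕ} (b : Fin N → KWBlock k)
    (X : Matrix (Fin 2) (Fin e) (MvPolynomial (Fin n) k)) : Prop :=
  ∃ (P : GL (Fin 2) k) (C : GL (Fin e) k),
    IsKWMatrix (n := n) (e := e) b
      ((Matrix.map P.val MvPolynomial.C : Matrix (Fin 2) (Fin 2) (MvPolynomial (Fin n) k)) * X *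
        (Matrix.map C.val MvPolynomial.C : Matrix (Fin e) (Fin e) (MvPolynomial (Fin n) k)))

/-- Some block of `b` is a scroll block of length `s`. -/
def HasScrollBlock {k : Type*} {N : ℕ} (b : Fin N → KWBlock k) (s : ℕ) : Prop :=
  ∃ i, b i = KWBlock.scroll s

/-- `φ` presents `k[x₁, …, xₙ] / (l₁, …, lᵣ)` as the polynomial ring `k[x₁, …, xₙ']`, sending
linear forms to linear forms; that is, `φ` eliminates variables by means of `l₁, …, lᵣ`. -/
structure IsLinearElimination {k : Type*} [Field k] {n n' r : ℕ}
    (l : Fin r → MvPolynomial (Fin n) k)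
    (φ : MvPolynomial (Fin n) k →ₐ[k] MvPolynomial (Fin n') k) : Prop where
  linear : ∀ i, (φ (MvPolynomial.X i)).IsHomogeneous 1
  surjective : Function.Surjective φ
  ker_eq : RingHom.ker φ = Ideal.span (Set.range l)

/-! ### Elimination of variables -/

open MvPolynomial in
/-- The ideal generated by finitely many linear forms is the kernel of an elimination of
variables. -/
theorem exists_isLinearElimination {k : Type*} [Field k] {n r : ℕ}
    (l : Fin r → MvPolynomial (Fin n) k) (hl : ∀ i, (l i).IsHomogeneous 1) :
    ∃ (n' : ℕ) (φ : MvPolynomial (Fin n) k →ₐ[k] MvPolynomial (Fin n') k),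
      IsLinearElimination l φ := by
  classical
  have hform : ∀ i, ∃ c : Fin n → k, Fintype.linearCombination k (X (R := k)) c = l i := by
    intro i
    have : l i ∈ Submodule.span k (Set.range (X (R := k) (σ := Fin n))) := by
      rw [← homogeneousSubmodule_one_eq_span_X]
      exact hl i
    rwa [← Fintype.range_linearCombination] at this
  choose c hc using hform
  let L : Submodule k (Fin n → k) := Submodule.span k (Set.range c)
  let B := Module.finBasis k ((Fin n → k) ⧸ L)
  let ψ : (Fin n → k) →ₗ[k] (Fin (Module.finrank k ((Fin n → k) ⧸ L)) → k) :=
    B.equivFun.toLinearMap ∘ₗ L.mkQ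
  have hψ : Function.Surjective ψ := B.equivFun.surjective.comp L.mkQ_surjective
  have hker : LinearMap.ker ψ = L := by
    simp [ψ, LinearMap.ker_comp]
  obtain ⟨σ, hσ⟩ := ψ.exists_rightInverse_of_surjective (LinearMap.range_eq_top.2 hψ)
  let φ : MvPolynomial (Fin n) k →ₐ[k] MvPolynomial (Fin (Module.finrank k ((Fin n → k) ⧸ L))) k :=
    aeval fun i => Fintype.linearCombination k X (ψ (Pi.single i 1))
  let τ : MvPolynomial (Fin (Module.finrank k ((Fin n → k) ⧸ L))) k →ₐ[k] MvPolynomial (Fin n) k :=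
    aeval fun i => Fintype.linearCombination k X (σ (Pi.single i 1))
  have hφ : ∀ v, φ (Fintype.linearCombination k X v) = Fintype.linearCombination k X (ψ v) := by
    intro v
    have : φ.toLinearMap ∘ₗ Fintype.linearCombination k X
        = Fintype.linearCombination k X ∘ₗ ψ := by
      ext i : 2
      simp [φ]
    exact LinearMap.congr_fun this v
  have hτ : ∀ v, τ (Fintype.linearCombination k X v) = Fintype.linearCombination k X (σ v) := by
    intro v
    have : τ.toLinearMap ∘ₗ Fintype.linearCombination k X
        = Fintype.linearCombination k X ∘ₗ σ := by
      ext i : 2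
      simp [τ]
    exact LinearMap.congr_fun this v
  have hX : ∀ {m : ℕ} (i : Fin m),
      (X i : MvPolynomial (Fin m) k) = Fintype.linearCombination k X (Pi.single i (1 : k)) := by
    intro m i
    simp
  have hφτ : φ.comp τ = AlgHom.id k _ := by
    ext1 i
    rw [AlgHom.comp_apply, hX i, hτ, hφ, AlgHom.id_apply]
    exact congrArg _ (LinearMap.congr_fun hσ _)
  have hL : ∀ v ∈ L, Fintype.linearCombination k X v ∈ Ideal.span (Set.range l) := by
    intro v hv
    have : L ≤ ((Ideal.span (Set.range l)).restrictScalars k).comap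
        (Fintype.linearCombination k X) := by
      refine Submodule.span_le.2 ?_
      rintro _ ⟨i, rfl⟩
      change Fintype.linearCombination k X (c i) ∈ Ideal.span (Set.range l)
      rw [hc]
      exact Ideal.subset_span ⟨i, rfl⟩
    exact this hv
  -- `v - σ (ψ v)` lies in `ker ψ = L`, so `τ ∘ φ` is the identity modulo `(l)`; hence `φ f = 0`
  -- forces `f ∈ (l)`.
  have hmk : ((Ideal.Quotient.mkₐ k (Ideal.span (Set.range l))).comp τ).comp φ
      = Ideal.Quotient.mkₐ k (Ideal.span (Set.range l)) := by
    ext1 i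
    rw [AlgHom.comp_apply, AlgHom.comp_apply, hX i, hφ, hτ]
    refine Ideal.Quotient.eq.2 ?_
    rw [← map_sub]
    refine hL _ ?_
    refine hker.le ?_
    rw [LinearMap.mem_ker, map_sub, sub_eq_zero]
    exact LinearMap.congr_fun hσ _
  refine ⟨_, φ, ⟨?_, ?_, ?_⟩⟩
  · intro i
    have : φ (X i) ∈ homogeneousSubmodule _ k 1 := by
      rw [hX i, hφ, homogeneousSubmodule_one_eq_span_X, ← Fintype.range_linearCombination]
      exact ⟨_, rfl⟩
    exact this
  · intro f
    exact ⟨τ f, AlgHom.congr_fun hφτ f⟩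
  · apply le_antisymm
    · intro f hf
      have := AlgHom.congr_fun hmk f
      rw [AlgHom.comp_apply, AlgHom.comp_apply, (RingHom.mem_ker).1 hf, map_zero, map_zero] at this
      exact Ideal.Quotient.eq_zero_iff_mem.1 this.symm
    · rw [Ideal.span_le]
      rintro _ ⟨i, rfl⟩
      change φ (l i) = 0
      have : ψ (c i) = 0 := by
        rw [← LinearMap.mem_ker, hker]
        exact Submodule.subset_span ⟨i, rfl⟩
      rw [← hc, hφ, this, map_zero]

/-! ### The determinantal ring of the image matrix -/

theorem minorsIdeal_map {S S' : Type*} [CommRing S] [CommRing S'] {e : ℕ}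
    (X : Matrix (Fin 2) (Fin e) S) (φ : S →+* S') :
    minorsIdeal (X.map φ) = (minorsIdeal X).map φ := by
  rw [minorsIdeal, minorsIdeal, Ideal.map_span, ← Set.range_comp]
  congr 2
  funext c
  simp [Matrix.det_fin_two]

/-- A surjection with kernel `(l₁, …, lᵣ)` identifies `R / (l₁, …, lᵣ)` with the determinantal ring
of the image matrix. -/
theorem exists_detRingQuot_algEquiv {k S S' : Type*} [CommRing k] [CommRing S] [CommRing S']
    [Algebra k S] [Algebra k S'] {e r : ℕ} (X : Matrix (Fin 2) (Fin e) S) (l : Fin r → S)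
    (φ : S →ₐ[k] S') (hφ : Function.Surjective φ)
    (hker : RingHom.ker φ = Ideal.span (Set.range l)) :
    ∃ ψ : DetRingQuot X l ≃ₐ[k] DetRing (X.map φ),
      ∀ f, ψ (Ideal.Quotient.mk _ (Ideal.Quotient.mk _ f)) = Ideal.Quotient.mk _ (φ f) := by
  have hI : minorsIdeal (X.map φ) = (minorsIdeal X).map φ := minorsIdeal_map X φ.toRingHom
  let Φ : S →ₐ[k] DetRing (X.map φ) := (Ideal.Quotient.mkₐ k _).comp φ
  let Φ₁ : DetRing X →ₐ[k] DetRing (X.map φ) := Ideal.Quotient.liftₐ _ Φ (by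
    intro a ha
    refine Ideal.Quotient.eq_zero_iff_mem.2 ?_
    rw [hI]
    exact Ideal.mem_map_of_mem φ ha)
  let Φ₂ : DetRingQuot X l →ₐ[k] DetRing (X.map φ) := Ideal.Quotient.liftₐ _ Φ₁ (by
    intro a ha
    have : Ideal.span (Set.range fun i => Ideal.Quotient.mk (minorsIdeal X) (l i))
        ≤ RingHom.ker Φ₁ := by
      rw [Ideal.span_le]
      rintro _ ⟨i, rfl⟩
      have h0 : φ (l i) = 0 := by
        rw [← RingHom.mem_ker, hker]
        exact Ideal.subset_span ⟨i, rfl⟩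
      change Ideal.Quotient.mk _ (φ (l i)) = 0
      rw [h0, map_zero]
    exact this ha)
  have hΦ₂ : ∀ f, Φ₂ (Ideal.Quotient.mk _ (Ideal.Quotient.mk _ f))
      = Ideal.Quotient.mk _ (φ f) := fun _ => rfl
  refine ⟨AlgEquiv.ofBijective Φ₂ ⟨?_, ?_⟩, hΦ₂⟩
  · rw [injective_iff_map_eq_zero]
    intro a ha
    obtain ⟨a, rfl⟩ := Ideal.Quotient.mk_surjective a
    obtain ⟨f, rfl⟩ := Ideal.Quotient.mk_surjective a
    -- The preimage of `φ(I₂(X))` is `I₂(X) + ker φ`, which is `I₂(X) + (l)`.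
    rw [hΦ₂, Ideal.Quotient.eq_zero_iff_mem, hI, ← Ideal.mem_comap,
      Ideal.comap_map_of_surjective' _ hφ, hker] at ha
    obtain ⟨g, hg, h, hh, rfl⟩ := Submodule.mem_sup.1 ha
    rw [Ideal.Quotient.eq_zero_iff_mem, map_add, Ideal.Quotient.eq_zero_iff_mem.2 hg, zero_add]
    have := Ideal.mem_map_of_mem (Ideal.Quotient.mk (minorsIdeal X)) hh
    rwa [Ideal.map_span, ← Set.range_comp] at this
  · intro a
    obtain ⟨a, rfl⟩ := Ideal.Quotient.mk_surjective a
    obtain ⟨f, rfl⟩ := hφ a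
    exact ⟨_, hΦ₂ f⟩

/-! ### Null vectors of single blocks -/

namespace KWBlock

theorem map_extend {k M M' : Type*} [Semiring k] [AddCommMonoid M] [AddCommMonoid M'] [Module k M]
    [Module k M'] (h : M →ₗ[k] M') {N : ℕ} (y : Fin N → M) (j : ℕ) :
    h (extend y j) = extend (fun i => h (y i)) j := by
  unfold extend
  split <;> simp

theorem extend_val {S : Type*} [Zero S] {N : ℕ} (y : Fin N → S) (j : Fin N) :
    extend y j.val = y j := by
  simp [extend]

theorem extend_of_le {S : Type*} [Zero S] {N : ℕ} (y : Fin N → S) {j : ℕ} (hj : N ≤ j) :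
    extend y j = 0 := by
  simp [extend, hj]

/-- Block entries are `k`-linear in the variables, so a functional on linear forms becomes a vector
of values substituted into each block. -/
theorem map_toMatrix {k S S' : Type*} [CommRing k] [CommRing S] [CommRing S'] [Algebra k S]
    [Algebra k S'] (h : S →ₗ[k] S') (b : KWBlock k) (y : Fin b.vars → S) (a : Fin 2)
    (j : Fin b.cols) : h (b.toMatrix y a j) = b.toMatrix (fun i => h (y i)) a j := by
  cases b <;> fin_cases a <;> simp [toMatrix, map_extend, apply_ite h]

theorem toMatrix_zero {k S : Type*} [CommRing k] [CommRing S] [Algebra k S] (b : KWBlock k) :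
    b.toMatrix (0 : Fin b.vars → S) = 0 := by
  ext a j
  exact (map_toMatrix (0 : S →ₗ[k] S) b 0 a j).symm

theorem toMatrix_isHomogeneous {k : Type*} [Field k] {n : ℕ} (b : KWBlock k)
    (y : Fin b.vars → MvPolynomial (Fin n) k) (hy : ∀ i, (y i).IsHomogeneous 1) (a : Fin 2)
    (j : Fin b.cols) : (b.toMatrix y a j).IsHomogeneous 1 := by
  have hext : ∀ j, extend y j ∈ MvPolynomial.homogeneousSubmodule (Fin n) k 1 := by
    intro j
    unfold extend
    split
    · exact hy _
    · exact Submodule.zero_mem _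
  change b.toMatrix y a j ∈ MvPolynomial.homogeneousSubmodule (Fin n) k 1
  cases b with
  | nilpotent m =>
    fin_cases a
    · simp only [toMatrix, Matrix.of_apply]
      change (if j.val = 0 then 0 else extend y (j.val - 1)) ∈ _
      split
      · exact Submodule.zero_mem _
      · exact hext _
    · exact hext _
  | scroll m => fin_cases a <;> exact hext _
  | jordan p c =>
    fin_cases a
    · exact hext _
    · exact Submodule.add_mem _ (hext _) (Submodule.smul_mem _ _ (hext _))

open Polynomial

/-- A polynomial null vector of the pencil of a block that is not a scroll block vanishes. -/
theorem eq_zero_of_X_mul_toMatrix {k : Type*} [Field k] (b : KWBlock k) (z : Fin b.vars → k[X])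
    (hz : ∀ j, X * b.toMatrix z 0 j = b.toMatrix z 1 j) (hb : ∀ t, b ≠ scroll t) : z = 0 := by
  suffices h : ∀ j, extend z j = 0 by
    funext j
    rw [← extend_val z j, h]
    rfl
  cases b with
  | scroll t => exact absurd rfl (hb t)
  | nilpotent m =>
    intro j
    -- Column `j` reads `z j = X * z (j - 1)`, starting from `z 0 = X * 0`, so zeros propagate
    -- upwards.
    induction j with
    | zero =>
      rcases Nat.eq_zero_or_pos m with rfl | hm
      · exact extend_of_le z (Nat.zero_le _)
      · have := hz ⟨0, hm⟩
        simpa [toMatrix] using this.symm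
    | succ j ih =>
      by_cases hj : j + 1 < m
      · have := hz ⟨j + 1, hj⟩
        simpa [toMatrix, ih] using this.symm
      · exact extend_of_le z (by simp only [vars]; omega)
  | jordan p c =>
    -- Descending induction from the end of the block: once `z (j + 1) = 0`, column `j` gives `(X -
    -- c) * z j = 0`.
    have key : ∀ i j, p ≤ i + j → extend z j = 0 := by
      intro i
      induction i with
      | zero => exact fun j hj => extend_of_le z (by simpa [vars] using hj)
      | succ i ih =>
        intro j hj
        by_cases hjp : j < p
        · have h := hz ⟨j, hjp⟩
          have h' : (X - C c) * extend z j = 0 := by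
            simp only [toMatrix, Matrix.of_apply, Matrix.cons_val_zero, Matrix.cons_val_one,
              ih (j + 1) (by omega), zero_add, Polynomial.smul_eq_C_mul] at h
            rw [sub_mul, h, sub_self]
          exact (mul_eq_zero.1 h').resolve_left (X_sub_C_ne_zero c)
        · exact extend_of_le z (by simpa [vars] using hjp)
    exact fun j => key p j (by omega)

/-- A null vector of degree at most `s` of the pencil of a scroll block of length more than `s`
vanishes. -/
theorem eq_zero_of_X_mul_toMatrix_scroll {k : Type*} [Field k] {s t : ℕ} (hst : s < t)
    (b : KWBlock k) (hb : b = scroll t) (z : Fin b.vars → k[X])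
    (hz : ∀ j, X * b.toMatrix z 0 j = b.toMatrix z 1 j)
    (hdeg : ∀ j, z j ∈ degreeLT k (s + 1)) : z = 0 := by
  subst hb
  -- The last variable has value `X ^ t * z 0`, of degree at least `t > s` unless `z 0 = 0`.
  have hpow : ∀ j ≤ t, extend z j = X ^ j * extend z 0 := by
    intro j
    induction j with
    | zero => simp
    | succ j ih =>
      intro hj
      have := hz ⟨j, hj⟩
      simp only [toMatrix, Matrix.of_apply, Matrix.cons_val_zero, Matrix.cons_val_one] at this
      rw [← this, ih (by omega), pow_succ']
      ring
  have h0 : extend z 0 = 0 := by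
    by_contra hne
    have h1 := hpow t le_rfl
    have h2 := hdeg ⟨t, Nat.lt_succ_self t⟩
    rw [← extend_val z, h1, mem_degreeLT, degree_mul, degree_X_pow, degree_eq_natDegree hne] at h2
    have h3 : t + (extend z 0).natDegree < s + 1 := by exact_mod_cast h2
    omega
  funext j
  rw [← extend_val z j, hpow _ (Nat.lt_succ_iff.1 j.isLt), h0, mul_zero]
  rfl

end KWBlock

/-! ### Null vectors of Kronecker–Weierstrass matrices -/

theorem IsKWMatrix.isHomogeneous {k : Type*} [Field k] {n e N : ℕ} {b : Fin N → KWBlock k}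
    {X : Matrix (Fin 2) (Fin e) (MvPolynomial (Fin n) k)} (hX : IsKWMatrix b X) (a : Fin 2)
    (j : Fin e) : (X a j).IsHomogeneous 1 := by
  obtain ⟨-, rfl, y, -, hspan, hy⟩ := hX
  obtain ⟨⟨i, j⟩, rfl⟩ := finSigmaFinEquiv.surjective j
  have := hy a i j
  rw [Fin.cast_eq_self] at this
  rw [this]
  refine KWBlock.toMatrix_isHomogeneous _ _ (fun q => ?_) _ _
  change y i q ∈ MvPolynomial.homogeneousSubmodule (Fin n) k 1
  rw [← hspan]
  exact Submodule.subset_span ⟨⟨i, q⟩, rfl⟩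

open Polynomial in
/-- If the pencil of a Kronecker-Weierstrass matrix has a nonzero polynomial null vector of degree
at most `s`, then the matrix has a scroll block of length at most `s`, and one of positive length
if the null vector does not annihilate all the entries. -/
theorem IsKWMatrix.exists_hasScrollBlock {k : Type*} [Field k] {n e N s : ℕ}
    {b : Fin N → KWBlock k} {M : Matrix (Fin 2) (Fin e) (MvPolynomial (Fin n) k)}
    (hM : IsKWMatrix b M) (h : MvPolynomial (Fin n) k →ₗ[k] k[X])
    (hdeg : ∀ f, h f ∈ degreeLT k (s + 1)) (hpencil : ∀ j, X * h (M 0 j) = h (M 1 j))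
    (hne : ∃ f ∈ MvPolynomial.homogeneousSubmodule (Fin n) k 1, h f ≠ 0)
    (hpos : 1 ≤ s → ∃ a j, h (M a j) ≠ 0) :
    ∃ t ≤ s, HasScrollBlock b t ∧ (1 ≤ s → 1 ≤ t) := by
  obtain ⟨-, rfl, y, -, hspan, hy⟩ := hM
  simp only [Fin.cast_eq_self] at hy
  have hz : ∀ i j, X * (b i).toMatrix (fun q => h (y i q)) 0 j
      = (b i).toMatrix (fun q => h (y i q)) 1 j := by
    intro i j
    rw [← KWBlock.map_toMatrix, ← KWBlock.map_toMatrix, ← hy, ← hy]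
    exact hpencil _
  have hblock : ∀ i, (fun q => h (y i q)) ≠ 0 → ∃ t ≤ s, b i = KWBlock.scroll t := by
    intro i hi
    by_contra hcon
    push Not at hcon
    by_cases hb : ∃ t, b i = KWBlock.scroll t
    · obtain ⟨t, ht⟩ := hb
      have hst : s < t := not_le.1 fun hle => hcon t hle ht
      exact hi (KWBlock.eq_zero_of_X_mul_toMatrix_scroll hst _ ht _ (hz i) fun _ => hdeg _)
    · exact hi (KWBlock.eq_zero_of_X_mul_toMatrix _ _ (hz i) (not_exists.1 hb))
  -- For `s ≥ 1` the block is chosen through a nonzero entry, so it has a column. For `s = 0` any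
  -- variable with nonzero value will do.
  by_cases hs : 1 ≤ s
  · obtain ⟨a, j, haj⟩ := hpos hs
    obtain ⟨⟨i, j⟩, rfl⟩ := finSigmaFinEquiv.surjective j
    rw [hy, KWBlock.map_toMatrix] at haj
    have hi : (fun q => h (y i q)) ≠ 0 := by
      intro h0
      rw [h0, KWBlock.toMatrix_zero] at haj
      exact haj rfl
    obtain ⟨t, ht, hb⟩ := hblock i hi
    refine ⟨t, ht, ⟨i, hb⟩, fun _ => ?_⟩
    have := j.pos
    rw [hb] at this
    exact this
  · obtain ⟨f, hf, hfne⟩ := hne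
    rw [← hspan] at hf
    have : ∃ i, (fun q => h (y i q)) ≠ 0 := by
      by_contra hcon
      push Not at hcon
      refine hfne ?_
      have hle : Submodule.span k (Set.range fun p : (Σ i, Fin (b i).vars) => y p.1 p.2)
          ≤ LinearMap.ker h := by
        rw [Submodule.span_le]
        rintro _ ⟨⟨i, q⟩, rfl⟩
        exact congrFun (hcon i) q
      exact hle hf
    obtain ⟨i, hi⟩ := this
    obtain ⟨t, ht, hb⟩ := hblock i hi
    exact ⟨t, ht, ⟨i, hb⟩, fun h => absurd h hs⟩

open Polynomial in
/-- A linear functional with polynomial values which sends the variables of a scroll block of length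
`s` to `u₁ˢ, u₁ˢ⁻¹u₂, …, u₂ˢ`, and those of the other blocks to zero, makes the two rows of a
Kronecker-Weierstrass matrix proportional to `u₁` and `u₂`. -/
theorem IsKWMatrix.exists_functional {k : Type*} [Field k] {n e N s : ℕ} {b : Fin N → KWBlock k}
    {M : Matrix (Fin 2) (Fin e) (MvPolynomial (Fin n) k)} (hM : IsKWMatrix b M)
    (hs : HasScrollBlock b s) (u : Fin 2 → k[X]) (hu : ∀ a, u a ≠ 0)
    (hdeg : ∀ a, u a ∈ degreeLE k 1) :
    ∃ g : MvPolynomial (Fin n) k →ₗ[k] k[X], (∀ f, g f ∈ degreeLT k (s + 1)) ∧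
      (∃ q : Fin e → k[X], ∀ a j, g (M a j) = u a * q j) ∧
      (∃ f ∈ MvPolynomial.homogeneousSubmodule (Fin n) k 1, g f ≠ 0) ∧
      (1 ≤ s → ∃ a j, g (M a j) ≠ 0) := by
  classical
  obtain ⟨-, rfl, y, hli, hspan, hy⟩ := hM
  simp only [Fin.cast_eq_self] at hy
  obtain ⟨i₀, hi₀⟩ := hs
  have hmem : ∀ q < s + 1, u 0 ^ (s - q) * u 1 ^ q ∈ degreeLT k (s + 1) := by
    intro q hq
    rw [mem_degreeLT]
    have h0 : (u 0).natDegree ≤ 1 := natDegree_le_of_degree_le (mem_degreeLE.1 (hdeg 0))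
    have h1 : (u 1).natDegree ≤ 1 := natDegree_le_of_degree_le (mem_degreeLE.1 (hdeg 1))
    have h : (u 0 ^ (s - q) * u 1 ^ q).natDegree ≤ (s - q) * 1 + q * 1 :=
      natDegree_mul_le_of_le (natDegree_pow_le_of_le _ h0) (natDegree_pow_le_of_le _ h1)
    refine (degree_le_of_natDegree_le h).trans_lt ?_
    exact_mod_cast (by omega : (s - q) * 1 + q * 1 < s + 1)
  -- Taking values in `degreeLT k (s + 1)` keeps the degree bound when the map is extended from
  -- linear forms to all polynomials.
  let v : (Σ i, Fin (b i).vars) → degreeLT k (s + 1) := fun p =>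
    if h : p.1 = i₀ ∧ p.2.val < s + 1 then ⟨_, hmem p.2.val h.2⟩ else 0
  obtain ⟨g₀, hg₀⟩ := ((Module.Basis.span hli).constr k v).exists_extend
  let g : MvPolynomial (Fin n) k →ₗ[k] k[X] := (degreeLT k (s + 1)).subtype ∘ₗ g₀
  have hg : ∀ p : (Σ i, Fin (b i).vars), g (y p.1 p.2) = v p := by
    intro p
    have := LinearMap.congr_fun hg₀ (Module.Basis.span hli p)
    rw [Module.Basis.constr_basis, LinearMap.comp_apply, Submodule.subtype_apply,
      Module.Basis.span_apply] at this
    rw [← this]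
    rfl
  have hvars : (b i₀).vars = s + 1 := by rw [hi₀]; rfl
  have hcols : (b i₀).cols = s := by rw [hi₀]; rfl
  have hg₁ : ∀ i ≠ i₀, (fun q => g (y i q)) = 0 := by
    intro i hi
    funext q
    rw [hg ⟨i, q⟩]
    simp [v, hi]
  have hg₂ : ∀ q : Fin (b i₀).vars, g (y i₀ q) = u 0 ^ (s - q.val) * u 1 ^ q.val := by
    intro q
    have hq : q.val < s + 1 := hvars ▸ q.isLt
    rw [hg ⟨i₀, q⟩]
    simp only [v]
    rw [dif_pos ⟨trivial, hq⟩]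
  have hrow : ∀ (a : Fin 2) (j : Fin (b i₀).cols), g (M a (finSigmaFinEquiv ⟨i₀, j⟩))
      = u a * (u 0 ^ (s - 1 - j.val) * u 1 ^ j.val) := by
    intro a j
    rw [hy, KWBlock.map_toMatrix]
    have hj : j.val < s := hcols ▸ j.isLt
    -- The block is generalized to `c` because the types of `z` and `j` depend on it.
    have key : ∀ (c : KWBlock k) (_ : c = KWBlock.scroll s) (z : Fin c.vars → k[X])
        (_ : ∀ q, z q = u 0 ^ (s - q.val) * u 1 ^ q.val) (j : Fin c.cols) (_ : j.val < s),
        c.toMatrix z a j = u a * (u 0 ^ (s - 1 - j.val) * u 1 ^ j.val) := by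
      rintro c rfl z hz j hj
      have h0 : KWBlock.extend z j.val = u 0 ^ (s - j.val) * u 1 ^ j.val := by
        rw [← hz ⟨j.val, Nat.lt_succ_of_lt hj⟩]
        exact KWBlock.extend_val z ⟨j.val, _⟩
      have h1 : KWBlock.extend z (j.val + 1) = u 0 ^ (s - (j.val + 1)) * u 1 ^ (j.val + 1) := by
        rw [← hz ⟨j.val + 1, Nat.succ_lt_succ hj⟩]
        exact KWBlock.extend_val z ⟨j.val + 1, _⟩
      fin_cases a
      · change KWBlock.extend z j.val = _
        rw [h0, show s - j.val = s - 1 - j.val + 1 by omega]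
        simp only [Fin.zero_eta]
        ring
      · change KWBlock.extend z (j.val + 1) = _
        rw [h1, show s - (j.val + 1) = s - 1 - j.val by omega]
        simp only [Fin.mk_one]
        ring
    exact key _ hi₀ _ hg₂ j hj
  let w : (Σ i, Fin (b i).cols) → k[X] := fun p =>
    if p.1 = i₀ then u 0 ^ (s - 1 - p.2.val) * u 1 ^ p.2.val else 0
  refine ⟨g, fun f => (g₀ f).2, ⟨fun j => w (finSigmaFinEquiv.symm j), ?_⟩, ?_, ?_⟩
  · intro a j
    obtain ⟨⟨i, j⟩, rfl⟩ := finSigmaFinEquiv.surjective j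
    change _ = u a * w (finSigmaFinEquiv.symm (finSigmaFinEquiv ⟨i, j⟩))
    rw [Equiv.symm_apply_apply]
    simp only [w]
    by_cases hi : i = i₀
    · subst hi
      rw [if_pos rfl]
      exact hrow a j
    · rw [if_neg hi, mul_zero, hy, KWBlock.map_toMatrix, hg₁ i hi, KWBlock.toMatrix_zero]
      rfl
  · let q : Fin (b i₀).vars := ⟨0, by omega⟩
    refine ⟨y i₀ q, ?_, ?_⟩
    · rw [← hspan]
      exact Submodule.subset_span ⟨⟨i₀, q⟩, rfl⟩
    · rw [hg₂]
      exact mul_ne_zero (pow_ne_zero _ (hu 0)) (pow_ne_zero _ (hu 1))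
  · intro hs
    refine ⟨0, finSigmaFinEquiv ⟨i₀, ⟨0, by omega⟩⟩, ?_⟩
    rw [hrow]
    exact mul_ne_zero (hu 0) (mul_ne_zero (pow_ne_zero _ (hu 0)) (pow_ne_zero _ (hu 1)))

open Polynomial in
/-- A scroll block of length `s` in a normal form of `M` gives a polynomial null vector of degree at
most `s` of the pencil of `M`. -/
theorem IsKWNormalForm.exists_functional {k : Type*} [Field k] {n e N s : ℕ}
    {b : Fin N → KWBlock k} {M : Matrix (Fin 2) (Fin e) (MvPolynomial (Fin n) k)}
    (hM : IsKWNormalForm b M) (hs : HasScrollBlock b s) :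
    ∃ g : MvPolynomial (Fin n) k →ₗ[k] k[X], (∀ f, g f ∈ degreeLT k (s + 1)) ∧
      (∀ j, X * g (M 0 j) = g (M 1 j)) ∧
      (∃ f ∈ MvPolynomial.homogeneousSubmodule (Fin n) k 1, g f ≠ 0) ∧
      (1 ≤ s → ∃ a j, g (M a j) ≠ 0) := by
  obtain ⟨P, D, hPD⟩ := hM
  let p : Fin 2 → k[X] := ![1, X]
  -- The null condition for `M` makes its rows proportional to `(1, X)`; for `P * M * D` the ratio
  -- becomes `P (1, X)`.
  let u : Fin 2 → k[X] := (P.val.map C).mulVec p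
  have hu' : ∀ a, u a = C (P.val a 0) + C (P.val a 1) * X := by
    intro a
    simp only [u, p, Matrix.mulVec, dotProduct, Fin.sum_univ_two, Matrix.map_apply]
    simp
  have hu : ∀ a, u a ≠ 0 := by
    intro a ha
    rw [hu'] at ha
    have h0 : P.val a 0 = 0 := by simpa using congrArg (coeff · 0) ha
    have h1 : P.val a 1 = 0 := by simpa using congrArg (coeff · 1) ha
    have hdet : P.val.det = 0 := Matrix.det_eq_zero_of_row_eq_zero a (by
      intro c
      fin_cases c
      · exact h0
      · exact h1)
    exact (P.det.ne_zero) hdet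
  have hdeg : ∀ a, u a ∈ degreeLE k 1 := by
    intro a
    rw [mem_degreeLE, hu', add_comm]
    exact degree_linear_le
  obtain ⟨g, hg, ⟨q, hq⟩, hne, hpos⟩ := hPD.exists_functional hs u hu hdeg
  let G : Matrix (Fin 2) (Fin e) k[X] := M.map g
  have hmap : ∀ a j, g (((Matrix.map P.val MvPolynomial.C :
      Matrix (Fin 2) (Fin 2) (MvPolynomial (Fin n) k)) * M *
      (Matrix.map D.val MvPolynomial.C : Matrix (Fin e) (Fin e) (MvPolynomial (Fin n) k))) a j)
      = (P.val.map C * G * D.val.map C) a j := by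
    intro a j
    simp only [Matrix.mul_apply, map_sum, Finset.sum_mul, Matrix.map_apply, G]
    refine Finset.sum_congr rfl fun x _ => Finset.sum_congr rfl fun z _ => ?_
    rw [mul_right_comm, ← map_mul, ← MvPolynomial.smul_eq_C_mul, map_smul, smul_eq_C_mul, map_mul]
    ring
  have hinv : ∀ {m : ℕ} (A : GL (Fin m) k), (A⁻¹).val.map C * A.val.map C
      = (1 : Matrix (Fin m) (Fin m) k[X]) := by
    intro m A
    rw [← Matrix.map_mul, ← Units.val_mul, inv_mul_cancel]
    simp
  have hinv' : ∀ {m : ℕ} (A : GL (Fin m) k), A.val.map C * (A⁻¹).val.map C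
      = (1 : Matrix (Fin m) (Fin m) k[X]) := by
    intro m A
    rw [← Matrix.map_mul, ← Units.val_mul, mul_inv_cancel]
    simp
  have hvec : P.val.map C * G * D.val.map C = P.val.map C * Matrix.vecMulVec p q := by
    ext1 a j
    rw [← hmap, hq, Matrix.mul_vecMulVec, Matrix.vecMulVec_apply]
  -- Cancelling `P` and `D` leaves a product of the column `(1, X)` with a row.
  have hG' : G = Matrix.vecMulVec p (Matrix.vecMul q ((D⁻¹).val.map C)) := by
    have h1 := congrArg (fun A => (P⁻¹).val.map C * A * (D⁻¹).val.map C) hvec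
    simp only [Matrix.mul_assoc, hinv', Matrix.mul_one] at h1
    simp only [← Matrix.mul_assoc, hinv, Matrix.one_mul] at h1
    rw [h1, Matrix.vecMulVec_mul]
  have hent : ∀ a j, g (M a j) = p a * (Matrix.vecMul q ((D⁻¹).val.map C)) j := by
    intro a j
    exact congrFun (congrFun hG' a) j
  refine ⟨g, hg, ?_, hne, ?_⟩
  · intro j
    rw [hent, hent]
    simp [p]
  · intro hs
    by_contra hcon
    push Not at hcon
    obtain ⟨a, j, haj⟩ := hpos hs
    refine haj ?_
    have hG0 : G = 0 := by
      ext1 a j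
      exact hcon a j
    rw [hmap, hG0]
    simp

/-! ### Lifting linear forms and the conclusion -/

/-- A homomorphism that maps variables to linear forms preserves homogeneity and degree. -/
theorem MvPolynomial.IsHomogeneous.map_of_linear {k : Type*} [Field k] {n n' d : ℕ}
    {φ : MvPolynomial (Fin n) k →ₐ[k] MvPolynomial (Fin n') k}
    (hφ : ∀ i, (φ (MvPolynomial.X i)).IsHomogeneous 1) {f : MvPolynomial (Fin n) k}
    (hf : f.IsHomogeneous d) : (φ f).IsHomogeneous d := by
  have := hf.aeval (fun i => φ (X i)) hφ
  rw [one_mul] at this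
  rwa [MvPolynomial.aeval_unique φ]

/-- An elimination of variables is surjective on linear forms. -/
theorem IsLinearElimination.exists_linear_preimage {k : Type*} [Field k] {n n' r : ℕ}
    {l : Fin r → MvPolynomial (Fin n) k}
    {φ : MvPolynomial (Fin n) k →ₐ[k] MvPolynomial (Fin n') k} (hφ : IsLinearElimination l φ)
    {f : MvPolynomial (Fin n') k} (hf : f.IsHomogeneous 1) :
    ∃ h : MvPolynomial (Fin n) k, h.IsHomogeneous 1 ∧ φ h = f := by
  obtain ⟨F, rfl⟩ := hφ.surjective f
  refine ⟨F.homogeneousComponent 1, MvPolynomial.homogeneousComponent_isHomogeneous 1 F, ?_⟩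
  have hF : MvPolynomial.homogeneousComponent 1 (φ F) = φ F := by
    rw [MvPolynomial.homogeneousComponent_of_mem hf, if_pos rfl]
  -- Since `φ` preserves degrees, only the degree-one component of `F` contributes to the degree-one
  -- part of `φ F`.
  conv_rhs => rw [← hF, ← F.sum_homogeneousComponent, map_sum, map_sum]
  rw [Finset.sum_eq_single 1]
  · have := (MvPolynomial.homogeneousComponent_isHomogeneous 1 F).map_of_linear hφ.linear
    rw [MvPolynomial.homogeneousComponent_of_mem this, if_pos rfl]
  · intro d _ hd
    have := (MvPolynomial.homogeneousComponent_isHomogeneous d F).map_of_linear hφ.linear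
    rw [MvPolynomial.homogeneousComponent_of_mem this, if_neg hd.symm]
  · intro h1
    have h0 : F.homogeneousComponent 1 = 0 :=
      MvPolynomial.homogeneousComponent_eq_zero _ _ (by simpa using h1)
    rw [h0, map_zero, map_zero]

theorem proposition3p2 {k : Type*} [Field k] [IsAlgClosed k] [CharZero k] {n e N r : ℕ}
    (X : Matrix (Fin 2) (Fin e) (MvPolynomial (Fin n) k))
    (b : Fin N → KWBlock k) (hX : IsKWMatrix b X)
    (l : Fin r → MvPolynomial (Fin n) k) (hl : ∀ i, (l i).IsHomogeneous 1) :
    (∃ (n' : ℕ) (φ : MvPolynomial (Fin n) k →ₐ[k] MvPolynomial (Fin n') k),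
      IsLinearElimination l φ) ∧
    ∀ (n' : ℕ) (φ : MvPolynomial (Fin n) k →ₐ[k] MvPolynomial (Fin n') k),
      IsLinearElimination l φ →
      ∀ X' : Matrix (Fin 2) (Fin e) (MvPolynomial (Fin n') k), X' = X.map φ →
        (∀ a j, (X' a j).IsHomogeneous 1) ∧
        (∃ ψ : DetRingQuot X l ≃ₐ[k] DetRing X',
          ∀ f, ψ (Ideal.Quotient.mk _ (Ideal.Quotient.mk _ f)) = Ideal.Quotient.mk _ (φ f)) ∧
        ∀ (N' : ℕ) (b' : Fin N' → KWBlock k), IsKWNormalForm b' X' →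
          ∀ s, HasScrollBlock b' s →
            ∃ t ≤ s, HasScrollBlock b t ∧ (1 ≤ s → 1 ≤ t) := by
  refine ⟨exists_isLinearElimination l hl, ?_⟩
  rintro n' φ hφ _ rfl
  refine ⟨fun a j => (hX.isHomogeneous a j).map_of_linear hφ.linear,
    exists_detRingQuot_algEquiv X l φ hφ.surjective hφ.ker_eq, ?_⟩
  intro N' b' hb' s hs
  obtain ⟨g, hdeg, hpencil, ⟨f, hf, hgf⟩, hpos⟩ := hb'.exists_functional hs
  obtain ⟨h, hh, rfl⟩ := hφ.exists_linear_preimage hf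
  exact hX.exists_hasScrollBlock (g ∘ₗ φ.toLinearMap) (fun _ => hdeg _) hpencil ⟨h, hh, hgf⟩ hpos
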